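/- Let $K$ be a finite extension of $\mathbb{Q}_p$ for some prime $p$, with ring of integers $\mathcal{O}$, maximal ideal $\mathfrak{p}$, and the conventions $\mathfrak{p}^{\infty}=0$. Let $n\ge 1$, $0\le r\le n-1$, $I=\mathbb{Z}^{n-1}$, and let $$F=K\{\{t_1\}\}\cdots\{\{t_r\}\}((t_{r+1}))\cdots((t_{n-1})),$$ whose elements are written $x=\sum_{\alpha\in I}x(\alpha)t^\alpha$ with $x(\alpha)\in K$. Here $E((t))$ is the space of series $\sum_{i\in\mathbb{Z}} x_it^i$ with $x_i\in E$ and $x_i=0$ for all sufficiently small $i$, and $E\{\{t\}\}$ is the space of series $\sum_{i\in\mathbb{Z}}x_it^i$ with $x_i\in E$, bounded for the valuation of $E$, and $x_i\to0$ for that valuation as $i\to-\infty$ (the valuation of $E\{\{t\}\}$ being the infimum of those of the coefficients). Equip $F$, as a $K$-vector space, with the higher topology, the translation invariant topology obtained from the $\mathfrak{p}$-adic topology of $K$ by adding the variables one at a time: a basis of neighbourhoods of zero of $E((t))$ is given by the sets $\{\sum x_it^i : x_i\in U_i \text{ for all } i\}$, where the $U_i$ are $\mathcal{O}$-submodules of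 $E$ that are neighbourhoods of zero and $U_i=E$ for all sufficiently large $i$; a basis of neighbourhoods of zero of $E\{\{t\}\}$ is given by the sets $\{\sum x_it^i : x_i\in V_i\text{ for all } i\}$, where the $V_i$ are $\mathcal{O}$-submodules of $E$ that are neighbourhoods of zero, $\mathfrak{p}_E^c\subseteq V_i$ for some integer $c$ and all $i$, and for every integer $d$ one has $\mathfrak{p}_E^d\subseteq V_i$ for all sufficiently large $i$. (Here $\mathfrak{p}_E$ is the maximal ideal of the ring of integers of $E$.) A basic compactoid submodule of $F$ is an $\mathcal{O}$-submodule of the form $$B=\sum_{\alpha\in I}\mathfrak{p}^{k(\alpha)}t^\alpha=\{x\in F : x(\alpha)\in\mathfrak{p}^{k(\alpha)}\text{ for all }\alpha\in I\},$$ where $(k(\alpha))_{\alpha\in I}\subset\mathbb{Z}\cup\{\infty\}$ satisfies, for all fixed integers $i_{l+1},\dots,i_{n-1}$: (i) for $l\in\{r+1,\dots,n-1\}$, there is $j_0\in\mathbb{Z}$ such that $k(\alpha)=\infty$ for every $j<j_0$ and every $\alpha\in I$ whose last coordinates, from the $l$-th on, are $(j,i_{l+1},\dots,i_{n-1})$;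 (ii) for $l\in\{1,\dots,r\}$, there is $d\in\mathbb{Z}$ such that $k(\alpha)\ge d$ for every $\alpha\in I$ whose last coordinates, from the $(l+1)$-th on, are $(i_{l+1},\dots,i_{n-1})$; and for every $N\in\mathbb{Z}$ there is $j_0\in\mathbb{Z}$ such that $k(\alpha)\ge N$ for every $j<j_0$ and every $\alpha\in I$ whose last coordinates, from the $l$-th on, are $(j,i_{l+1},\dots,i_{n-1})$. An $\mathcal{O}$-submodule $A$ of a locally convex $K$-vector space $V$ is c-compact if for every decreasing filtered family $(\Lambda_h)_h$ of open lattices of $V$ the canonical map $A\to\varprojlim_h A/(\Lambda_h\cap A)$ is surjective. **Corollary.** Every basic compactoid $\mathcal{O}$-submodule $B$ of $F$ is c-compact. -/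

import Mathlib

noncomputable section

namespace HigherLocal

/-! ### The base field -/

/-- The ring of integers `𝒪 = {x | ‖x‖ ≤ 1}` of a nonarchimedean normed field. -/
abbrev integers (K : Type*) [NormedField K] [IsUltrametricDist K] : Subring K :=
  (NormedField.valuation (K := K)).integer

/-- `ϖ` is a uniformizer of `K`: a generator of the maximal ideal `𝔭 = {x | ‖x‖ < 1}` of `𝒪`. -/
def IsUniformizer {K : Type*} [NormedField K] (ϖ : K) : Prop :=
  ϖ ≠ 0 ∧ ‖ϖ‖ < 1 ∧ ∀ x : K, ‖x‖ < 1 → ‖x‖ ≤ ‖ϖ‖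

/-- The fractional ideal `𝔭 ^ k = ϖ ^ k 𝒪` for `k ∈ ℤ ∪ {∞}`, with `𝔭 ^ ∞ = 0`.
All uniformizers have the same absolute value, so it does not depend on one. -/
def primePow (K : Type*) [NormedField K] [IsUltrametricDist K] :
    WithTop ℤ → Submodule (integers K) K
  | none => ⊥
  | some k =>
    { carrier := {x | ∀ ϖ : K, IsUniformizer ϖ → ‖x‖ ≤ ‖ϖ‖ ^ k}
      zero_mem' := fun ϖ _ => by
        rw [norm_zero]; exact zpow_nonneg (norm_nonneg ϖ) k
      add_mem' := fun {a b} ha hb ϖ hϖ =>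
        (IsUltrametricDist.norm_add_le_max a b).trans (max_le (ha ϖ hϖ) (hb ϖ hϖ))
      smul_mem' := fun c {x} hx ϖ hϖ => by
        have hc : ‖(c : K)‖ ≤ 1 := c.2
        calc ‖c • x‖ = ‖(c : K)‖ * ‖x‖ := norm_mul _ _
          _ ≤ ‖x‖ := mul_le_of_le_one_left (norm_nonneg x) hc
          _ ≤ ‖ϖ‖ ^ k := hx ϖ hϖ }

/-! ### The `K`-vector space `F = K{{t₁}}⋯{{t_r}}((t_{r+1}))⋯((t_m))`, where `m = n - 1`

An element is given by its family of coefficients `x(α) ∈ K`, `α ∈ I = ℤ ^ m`. Coordinates are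
numbered from `0`: the coordinate `l : Fin m` of `α` is the exponent of `t_{l+1}`. -/

/-- Families of coefficients indexed by `ℤ ^ m`. -/
abbrev Coeffs (K : Type*) (m : ℕ) : Type _ := (Fin m → ℤ) → K

/-- The coefficient of `t_{m+1} ^ i`: the family `β ↦ x(β, i)`. -/
def coeffSlice (K : Type*) [NormedField K] {m : ℕ} (i : ℤ) :
    Coeffs K (m + 1) →ₗ[K] Coeffs K m :=
  LinearMap.funLeft K K fun β => (Fin.snoc β i : Fin (m + 1) → ℤ)

/-- `E((t))`: series `∑ xᵢ tⁱ` with `xᵢ ∈ E`, and `xᵢ = 0` for all sufficiently small `i`. -/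
def laurentStep {K : Type*} [NormedField K] {m : ℕ} (E : Submodule K (Coeffs K m)) :
    Submodule K (Coeffs K (m + 1)) where
  carrier := {x | (∀ i, coeffSlice K i x ∈ E) ∧ ∃ i₀ : ℤ, ∀ i < i₀, coeffSlice K i x = 0}
  zero_mem' := ⟨fun i => by simp, 0, fun i _ => by simp⟩
  add_mem' := by
    rintro x y ⟨hx, i, hi⟩ ⟨hy, j, hj⟩
    refine ⟨fun l => by rw [map_add]; exact E.add_mem (hx l) (hy l), min i j, fun l hl => ?_⟩
    rw [map_add, hi l (lt_of_lt_of_le hl (min_le_left _ _)),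
      hj l (lt_of_lt_of_le hl (min_le_right _ _)), add_zero]
  smul_mem' := by
    rintro c x ⟨hx, i, hi⟩
    refine ⟨fun l => by rw [map_smul]; exact E.smul_mem c (hx l), i, fun l hl => ?_⟩
    rw [map_smul, hi l hl, smul_zero]

/-- `E{{t}}`: series `∑ xᵢ tⁱ` over all `i ∈ ℤ` with `xᵢ ∈ E` bounded for the valuation of `E`, and
`xᵢ → 0` for the valuation of `E` as `i → -∞`. It is applied only when `E = K{{t₁}}⋯{{t_m}}`,
whose absolute value is the supremum of the absolute values of the coefficients in `K`. -/
def mixedStep {K : Type*} [NormedField K] {m : ℕ} (E : Submodule K (Coeffs K m)) :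
    Submodule K (Coeffs K (m + 1)) where
  carrier := {x | (∀ i, coeffSlice K i x ∈ E) ∧
    (∃ C : ℝ, ∀ i β, ‖coeffSlice K i x β‖ ≤ C) ∧
    ∀ ε : ℝ, 0 < ε → ∃ i₀ : ℤ, ∀ i < i₀, ∀ β, ‖coeffSlice K i x β‖ ≤ ε}
  zero_mem' := ⟨fun i => by simp, ⟨0, fun i β => by simp⟩,
    fun ε hε => ⟨0, fun i _ β => by simpa using hε.le⟩⟩
  add_mem' := by
    rintro x y ⟨hx, ⟨C, hC⟩, hx0⟩ ⟨hy, ⟨D, hD⟩, hy0⟩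
    refine ⟨fun l => by rw [map_add]; exact E.add_mem (hx l) (hy l),
      ⟨C + D, fun i β => ?_⟩, fun ε hε => ?_⟩
    · rw [map_add]
      exact (norm_add_le _ _).trans (add_le_add (hC i β) (hD i β))
    · obtain ⟨i, hi⟩ := hx0 (ε / 2) (half_pos hε)
      obtain ⟨j, hj⟩ := hy0 (ε / 2) (half_pos hε)
      refine ⟨min i j, fun l hl β => ?_⟩
      rw [map_add, ← add_halves ε]
      exact (norm_add_le _ _).trans (add_le_add
        (hi l (lt_of_lt_of_le hl (min_le_left _ _)) β)
        (hj l (lt_of_lt_of_le hl (min_le_right _ _)) β))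
  smul_mem' := by
    rintro c x ⟨hx, ⟨C, hC⟩, hx0⟩
    have hc : (0 : ℝ) < ‖c‖ + 1 := by positivity
    refine ⟨fun l => by rw [map_smul]; exact E.smul_mem c (hx l),
      ⟨‖c‖ * C, fun i β => ?_⟩, fun ε hε => ?_⟩
    · rw [map_smul, Pi.smul_apply, norm_smul]
      exact mul_le_mul_of_nonneg_left (hC i β) (norm_nonneg c)
    · obtain ⟨i, hi⟩ := hx0 (ε / (‖c‖ + 1)) (div_pos hε hc)
      refine ⟨i, fun l hl β => ?_⟩
      rw [map_smul, Pi.smul_apply, norm_smul]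
      calc ‖c‖ * ‖coeffSlice K l x β‖ ≤ (‖c‖ + 1) * (ε / (‖c‖ + 1)) :=
            mul_le_mul (by linarith) (hi l hl β) (norm_nonneg _) hc.le
        _ = ε := mul_div_cancel₀ ε hc.ne'

/-- The coefficient families of the elements of `K{{t₁}}⋯{{t_r}}((t_{r+1}))⋯((t_m))`, built one
variable at a time, starting from `K`. -/
def seriesSpace (K : Type*) [NormedField K] (r : ℕ) : (m : ℕ) → Submodule K (Coeffs K m)
  | 0 => ⊤
  | m + 1 => if m < r then mixedStep (seriesSpace K r m) else laurentStep (seriesSpace K r m)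

/-- The space `F = K{{t₁}}⋯{{t_r}}((t_{r+1}))⋯((t_m))`; it is a type of its own so that it can carry
the higher topology instead of the topology of coefficientwise convergence. -/
def HLF (K : Type*) [NormedField K] (r m : ℕ) : Type _ := ↥(seriesSpace K r m)

section Basic

variable (K : Type*) [NormedField K] (r m : ℕ)

instance : AddCommGroup (HLF K r m) := inferInstanceAs (AddCommGroup ↥(seriesSpace K r m))

instance : Module K (HLF K r m) := inferInstanceAs (Module K ↥(seriesSpace K r m))

/-- The coefficient family `α ↦ x(α)` of an element `x = ∑ x(α) t ^ α` of `F`. -/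
def coeff : HLF K r m →ₗ[K] Coeffs K m := (seriesSpace K r m).subtype

theorem coeffSlice_mem (i : ℤ) {x : Coeffs K (m + 1)} (hx : x ∈ seriesSpace K r (m + 1)) :
    coeffSlice K i x ∈ seriesSpace K r m := by
  rw [seriesSpace] at hx
  split_ifs at hx
  · exact hx.1 i
  · exact hx.1 i

/-- For `x = ∑ xᵢ t_{m+1} ^ i ∈ F`, the coefficient `xᵢ ∈ L`, where `L` is the field of series in
`t₁, …, t_m`. -/
def slice (i : ℤ) : HLF K r (m + 1) →ₗ[K] HLF K r m :=
  LinearMap.codRestrict (seriesSpace K r m)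
    ((coeffSlice K i).comp (seriesSpace K r (m + 1)).subtype)
    fun x => coeffSlice_mem K r m i x.2

end Basic

/-! ### The higher topology -/

section Topology

variable (K : Type*) [NormedField K] [IsUltrametricDist K] (r : ℕ)

/-- For a net `k : I → ℤ ∪ {∞}`, the `𝒪`-submodule `∑_α 𝔭 ^ k(α) t ^ α` of the `x ∈ F` with
`x(α) ∈ 𝔭 ^ k(α)` for all `α`. -/
def netSubmodule (m : ℕ) (k : (Fin m → ℤ) → WithTop ℤ) : Submodule (integers K) (HLF K r m) where
  carrier := {x | ∀ α, coeff K r m x α ∈ primePow K (k α)}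
  zero_mem' := fun α => by rw [map_zero]; exact (primePow K (k α)).zero_mem
  add_mem' := fun {x y} hx hy α => by
    rw [map_add]; exact (primePow K (k α)).add_mem (hx α) (hy α)
  smul_mem' := fun c {x} hx α => by
    change coeff K r m ((c : K) • x) α ∈ _
    rw [map_smul]
    exact (primePow K (k α)).smul_mem c (hx α)

/-- The power `𝔭_F ^ c` of the valuation ideal of `F = K{{t₁}}⋯{{t_m}}` (used only for `m < r`),
whose valuation is the infimum of the valuations of the coefficients in `K`. -/
def ballPow (m : ℕ) (c : ℤ) : Submodule (integers K) (HLF K r m) :=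
  netSubmodule K r m fun _ => (c : WithTop ℤ)

/-- The `𝒪`-submodule `Λ` of `F` is a neighbourhood of zero for the higher topology, by recursion on
the number of variables.
* On `K`: `Λ` contains some `𝔭 ^ k`.
* On `L{{t}}`: `Λ` contains some `∑ Vᵢ tⁱ`, where the `Vᵢ` are `𝒪`-submodules of `L` which are
  neighbourhoods of zero, `𝔭_L ^ c ⊆ Vᵢ` for some `c` and all `i`, and for every `d` one has
  `𝔭_L ^ d ⊆ Vᵢ` for all sufficiently large `i`.
* On `L((t))`: `Λ` contains some `∑ Uᵢ tⁱ`, where the `Uᵢ` are `𝒪`-submodules of `L` which are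
  neighbourhoods of zero, and `Uᵢ = L` for all sufficiently large `i`. -/
def IsZeroNhd : (m : ℕ) → Submodule (integers K) (HLF K r m) → Prop
  | 0, Λ => ∃ k : ℤ, netSubmodule K r 0 (fun _ => (k : WithTop ℤ)) ≤ Λ
  | m + 1, Λ =>
    ∃ U : ℤ → Submodule (integers K) (HLF K r m),
      (∀ i, IsZeroNhd m (U i)) ∧
      (if m < r then
        (∃ c : ℤ, ∀ i, ballPow K r m c ≤ U i) ∧
          ∀ d : ℤ, ∃ i₀ : ℤ, ∀ i ≥ i₀, ballPow K r m d ≤ U i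
      else ∃ i₀ : ℤ, ∀ i ≥ i₀, U i = ⊤) ∧
      ∀ x : HLF K r (m + 1), (∀ i, slice K r m i x ∈ U i) → x ∈ Λ

theorem primePow_anti {a b : ℤ} (h : a ≤ b) :
    primePow K (b : WithTop ℤ) ≤ primePow K (a : WithTop ℤ) := by
  intro x hx ϖ hϖ
  exact (hx ϖ hϖ).trans
    (zpow_le_zpow_right_of_le_one₀ (norm_pos_iff.2 hϖ.1) hϖ.2.1.le h)

theorem ballPow_anti (m : ℕ) {a b : ℤ} (h : a ≤ b) : ballPow K r m b ≤ ballPow K r m a :=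
  fun _ hx α => primePow_anti K h (hx α)

theorem IsZeroNhd.top : ∀ m, IsZeroNhd K r m ⊤
  | 0 => ⟨0, le_top⟩
  | m + 1 => by
    refine ⟨fun _ => ⊤, fun _ => IsZeroNhd.top m, ?_, fun _ _ => trivial⟩
    split_ifs
    · exact ⟨⟨0, fun _ => le_top⟩, fun _ => ⟨0, fun _ _ => le_top⟩⟩
    · exact ⟨0, fun _ _ => rfl⟩

theorem IsZeroNhd.inf : ∀ m {Λ Λ' : Submodule (integers K) (HLF K r m)},
    IsZeroNhd K r m Λ → IsZeroNhd K r m Λ' → IsZeroNhd K r m (Λ ⊓ Λ')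
  | 0, Λ, Λ', ⟨a, ha⟩, ⟨b, hb⟩ =>
    ⟨max a b, le_inf ((ballPow_anti K r 0 (le_max_left a b)).trans ha)
      ((ballPow_anti K r 0 (le_max_right a b)).trans hb)⟩
  | m + 1, Λ, Λ', ⟨U, hU, hc, h⟩, ⟨U', hU', hc', h'⟩ => by
    refine ⟨fun i => U i ⊓ U' i, fun i => IsZeroNhd.inf m (hU i) (hU' i), ?_,
      fun x hx => ⟨h x fun i => (hx i).1, h' x fun i => (hx i).2⟩⟩
    split_ifs at hc hc' ⊢
    · obtain ⟨⟨a, ha⟩, hd⟩ := hc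
      obtain ⟨⟨b, hb⟩, hd'⟩ := hc'
      refine ⟨⟨max a b, fun i => le_inf
        ((ballPow_anti K r m (le_max_left a b)).trans (ha i))
        ((ballPow_anti K r m (le_max_right a b)).trans (hb i))⟩, fun d => ?_⟩
      obtain ⟨i, hi⟩ := hd d
      obtain ⟨j, hj⟩ := hd' d
      exact ⟨max i j, fun l hl => le_inf (hi l ((le_max_left i j).trans hl))
        (hj l ((le_max_right i j).trans hl))⟩
    · obtain ⟨i, hi⟩ := hc
      obtain ⟨j, hj⟩ := hc'
      refine ⟨max i j, fun l hl => ?_⟩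
      change U l ⊓ U' l = ⊤
      rw [hi l ((le_max_left i j).trans hl), hj l ((le_max_right i j).trans hl), inf_top_eq]

/-- The basis of neighbourhoods of zero of the higher topology. -/
@[reducible] def zeroBasis (m : ℕ) : AddGroupFilterBasis (HLF K r m) where
  sets := {S | ∃ Λ : Submodule (integers K) (HLF K r m), IsZeroNhd K r m Λ ∧ S = Λ}
  nonempty := ⟨_, ⊤, IsZeroNhd.top K r m, rfl⟩
  inter_sets := by
    rintro _ _ ⟨Λ, h, rfl⟩ ⟨Λ', h', rfl⟩
    exact ⟨_, ⟨Λ ⊓ Λ', IsZeroNhd.inf K r m h h', rfl⟩, fun x hx => hx⟩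
  zero' := by
    rintro _ ⟨Λ, _, rfl⟩
    exact Λ.zero_mem
  add' := by
    rintro _ ⟨Λ, h, rfl⟩
    refine ⟨_, ⟨Λ, h, rfl⟩, ?_⟩
    rintro _ ⟨x, hx, y, hy, rfl⟩
    exact Λ.add_mem hx hy
  neg' := by
    rintro _ ⟨Λ, h, rfl⟩
    exact ⟨_, ⟨Λ, h, rfl⟩, fun x hx => Λ.neg_mem hx⟩
  conj' := by
    rintro x _ ⟨Λ, h, rfl⟩
    refine ⟨_, ⟨Λ, h, rfl⟩, fun y hy => ?_⟩
    have e : x + y + -x = y := by abel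
    change x + y + -x ∈ Λ
    rw [e]
    exact hy

/-- The higher topology on `F`: the translation invariant topology with the above basis of
neighbourhoods of zero. -/
instance (m : ℕ) : TopologicalSpace (HLF K r m) := (zeroBasis K r m).topology

end Topology

/-! ### c-compactness -/

section CCompact

variable {K : Type*} [NormedField K] [IsUltrametricDist K]
  {V : Type*} [AddCommGroup V] [Module K V] [TopologicalSpace V]

/-- An open lattice of `V`: an open `𝒪`-submodule `Λ` such that every `v ∈ V` has a nonzero
`K`-multiple in `Λ`. -/
def IsOpenLattice (Λ : Submodule (integers K) V) : Prop :=
  IsOpen (Λ : Set V) ∧ ∀ v : V, ∃ a : K, a ≠ 0 ∧ a • v ∈ Λ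

/-- An `𝒪`-submodule `A` of `V` is c-compact if, for every decreasing filtered family of open
lattices `Λ` of `V`, the canonical map `A → lim A / (Λ ∩ A)` is surjective. A filtered family may be
replaced by the set of its members, so families are sets `S` of open lattices, directed by reverse
inclusion; an element of the limit is a family `x` compatible with the projections
`A / (Λ ∩ A) → A / (Λ' ∩ A)` for `Λ ≤ Λ'`. -/
def IsCCompact (A : Submodule (integers K) V) : Prop :=
  ∀ S : Set (Submodule (integers K) V), S.Nonempty → (∀ Λ ∈ S, IsOpenLattice Λ) →
    DirectedOn (fun Λ Λ' => Λ' ≤ Λ) S →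
    ∀ x : (Λ : S) → A ⧸ (Λ : Submodule (integers K) V).comap A.subtype,
      (∀ (Λ Λ' : S) (h : (Λ : Submodule (integers K) V) ≤ Λ'),
        Submodule.factor (Submodule.comap_mono (f := A.subtype) h) (x Λ) = x Λ') →
      ∃ a : A, ∀ Λ : S, Submodule.Quotient.mk a = x Λ

end CCompact

/-! ### Basic compactoid submodules -/

/-- The conditions on a net `k : I = ℤ ^ m → ℤ ∪ {∞}`. Coordinates are numbered from `0`; `i` is the
choice of the fixed indices, of which only the coordinates beyond `l` matter. -/
structure IsCompactoidNet (r : ℕ) {m : ℕ} (k : (Fin m → ℤ) → WithTop ℤ) : Prop where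
  laurent : ∀ l : Fin m, r ≤ (l : ℕ) → ∀ i : Fin m → ℤ, ∃ j₀ : ℤ, ∀ j < j₀,
    ∀ α : Fin m → ℤ, α l = j → (∀ l' > l, α l' = i l') → k α = ⊤
  bounded : ∀ l : Fin m, (l : ℕ) < r → ∀ i : Fin m → ℤ, ∃ d : ℤ,
    ∀ α : Fin m → ℤ, (∀ l' > l, α l' = i l') → (d : WithTop ℤ) ≤ k α
  tendsto : ∀ l : Fin m, (l : ℕ) < r → ∀ i : Fin m → ℤ, ∀ N : ℤ, ∃ j₀ : ℤ, ∀ j < j₀,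
    ∀ α : Fin m → ℤ, α l = j → (∀ l' > l, α l' = i l') → (N : WithTop ℤ) ≤ k α

/-- Basic compactoid submodules of `F`: those of the form `∑_α 𝔭 ^ k(α) t ^ α`. -/
def IsBasicCompactoid {K : Type*} [NormedField K] [IsUltrametricDist K] {r m : ℕ}
    (B : Submodule (integers K) (HLF K r m)) : Prop :=
  ∃ k : (Fin m → ℤ) → WithTop ℤ, IsCompactoidNet r k ∧ B = netSubmodule K r m k

end HigherLocal

end

/-!
A basic compactoid submodule `B` with net `k` is compact for the higher topology, and a compact
submodule is c-compact.

* Compactness. As `K` is locally compact, every `𝔭 ^ k(α)` is compact, and so is the product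
  `∏_α 𝔭 ^ k(α)` for the topology of coefficientwise convergence. The conditions on the net say that
  every family in this product is the family of coefficients of an element of `F`
  (`mem_seriesSpace_of_isCompactoidNet`), so the product is in bijection with `B`. They also say
  that on `B` the higher topology is no finer than coefficientwise convergence: a neighbourhood
  `∑ Uᵢ tⁱ` of zero constrains the coefficients of elements of `B` for finitely many `i` only, and one
  concludes by induction on the number of variables (`IsZeroNhd.eventually_coeff`). Hence `B` is
  a continuous image of the product.
* c-compactness (`isCCompact_of_isCompact`). A compatible family of classes is a directed
  family of nonempty traces on `B` of cosets of open lattices. Open subgroups are closed, so by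
  compactness these traces have a common point.
-/

open Filter Topology

namespace HigherLocal

/-! ### The fractional ideals of the base field -/

section Field

variable {K : Type*}

/-- In a proper field the maximal ideal is compact, and a uniformizer is an element at which the
absolute value attains its maximum there. -/
theorem exists_isUniformizer [NontriviallyNormedField K] [IsUltrametricDist K] [ProperSpace K] :
    ∃ ϖ : K, IsUniformizer ϖ := by
  have hc : IsCompact (Metric.ball (0 : K) 1) :=
    (isCompact_closedBall (0 : K) 1).of_isClosed_subset (IsUltrametricDist.isClosed_ball 0 1)
      Metric.ball_subset_closedBall
  obtain ⟨ϖ, hϖ, hmax⟩ := hc.exists_isMaxOn ⟨0, by simp⟩ continuous_norm.continuousOn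
  obtain ⟨y, hy0, hy1⟩ := NormedField.exists_norm_lt_one K
  have hle : ∀ x : K, ‖x‖ < 1 → ‖x‖ ≤ ‖ϖ‖ := fun x hx => hmax (by simpa using hx)
  exact ⟨ϖ, norm_pos_iff.1 (hy0.trans_le (hle y hy1)), by simpa using hϖ, hle⟩

variable [NormedField K] [IsUltrametricDist K]

theorem coe_primePow_eq_closedBall {ϖ : K} (hϖ : IsUniformizer ϖ) (n : ℤ) :
    (primePow K (n : WithTop ℤ) : Set K) = Metric.closedBall 0 (‖ϖ‖ ^ n) := by
  ext x
  rw [mem_closedBall_zero_iff]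
  refine ⟨fun hx => hx ϖ hϖ, fun hx ϖ' hϖ' => ?_⟩
  rwa [le_antisymm (hϖ'.2.2 ϖ hϖ.2.1) (hϖ.2.2 ϖ' hϖ'.2.1)] at hx

theorem primePow_le_coe {n : ℤ} {a : WithTop ℤ} (h : (n : WithTop ℤ) ≤ a) :
    primePow K a ≤ primePow K (n : WithTop ℤ) := by
  induction a with
  | top => exact (bot_le : (⊥ : Submodule (integers K) K) ≤ _)
  | coe b => exact primePow_anti K (WithTop.coe_le_coe.1 h)

theorem eq_zero_of_mem_primePow_top {x : K} (hx : x ∈ primePow K ⊤) : x = 0 :=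
  (Submodule.mem_bot (integers K)).1 hx

theorem isCompact_primePow [ProperSpace K] {ϖ : K} (hϖ : IsUniformizer ϖ) (a : WithTop ℤ) :
    IsCompact (primePow K a : Set K) := by
  induction a with
  | top => exact (isCompact_singleton : IsCompact ({0} : Set K))
  | coe n =>
    rw [coe_primePow_eq_closedBall hϖ]
    exact isCompact_closedBall _ _

theorem primePow_mem_nhds {ϖ : K} (hϖ : IsUniformizer ϖ) (n : ℤ) :
    (primePow K (n : WithTop ℤ) : Set K) ∈ 𝓝 0 := by
  rw [coe_primePow_eq_closedBall hϖ]
  exact Metric.closedBall_mem_nhds _ (zpow_pos (norm_pos_iff.2 hϖ.1) n)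

end Field

/-! ### Nets in one variable less -/

namespace IsCompactoidNet

variable {r m : ℕ} {k : (Fin (m + 1) → ℤ) → WithTop ℤ}

/-- The net of the coefficients of `t_{m+1} ^ i`. -/
theorem slice (hk : IsCompactoidNet r k) (i : ℤ) :
    IsCompactoidNet r fun β : Fin m → ℤ => k (Fin.snoc β i : Fin (m + 1) → ℤ) := by
  have key : ∀ (l : Fin m) (β β' : Fin m → ℤ), (∀ l' > l, β l' = β' l') →
      ∀ l' > l.castSucc, (Fin.snoc β i : Fin (m + 1) → ℤ) l' =
        (Fin.snoc β' i : Fin (m + 1) → ℤ) l' := by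
    intro l β β' h l'
    refine Fin.lastCases (fun _ => by simp) (fun l'' hl => ?_) l'
    simpa using h l'' (Fin.castSucc_lt_castSucc_iff.1 hl)
  constructor
  · intro l hl i'
    obtain ⟨j₀, h⟩ := hk.laurent l.castSucc hl (Fin.snoc i' i)
    exact ⟨j₀, fun j hj β hβ hβ' => h j hj _ (by simpa using hβ) (key l β i' hβ')⟩
  · intro l hl i'
    obtain ⟨d, h⟩ := hk.bounded l.castSucc hl (Fin.snoc i' i)
    exact ⟨d, fun β hβ' => h _ (key l β i' hβ')⟩
  · intro l hl i' N
    obtain ⟨j₀, h⟩ := hk.tendsto l.castSucc hl (Fin.snoc i' i) N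
    exact ⟨j₀, fun j hj β hβ hβ' => h j hj _ (by simpa using hβ) (key l β i' hβ')⟩

theorem laurent_last (hk : IsCompactoidNet r k) (hm : ¬ m < r) :
    ∃ j₀ : ℤ, ∀ j < j₀, ∀ β : Fin m → ℤ, k (Fin.snoc β j : Fin (m + 1) → ℤ) = ⊤ := by
  obtain ⟨j₀, h⟩ := hk.laurent (Fin.last m) (not_lt.1 hm) 0
  exact ⟨j₀, fun j hj β => h j hj _ (by simp) fun l' hl => absurd hl (Fin.le_last l').not_gt⟩

theorem bounded_last (hk : IsCompactoidNet r k) (hm : m < r) :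
    ∃ d : ℤ, ∀ α, (d : WithTop ℤ) ≤ k α := by
  obtain ⟨d, h⟩ := hk.bounded (Fin.last m) hm 0
  exact ⟨d, fun α => h α fun l' hl => absurd hl (Fin.le_last l').not_gt⟩

theorem tendsto_last (hk : IsCompactoidNet r k) (hm : m < r) (N : ℤ) :
    ∃ j₀ : ℤ, ∀ j < j₀, ∀ β : Fin m → ℤ,
      (N : WithTop ℤ) ≤ k (Fin.snoc β j : Fin (m + 1) → ℤ) := by
  obtain ⟨j₀, h⟩ := hk.tendsto (Fin.last m) hm 0 N
  exact ⟨j₀, fun j hj β => h j hj _ (by simp) fun l' hl => absurd hl (Fin.le_last l').not_gt⟩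

end IsCompactoidNet

/-! ### Basic compactoid submodules and coefficientwise convergence -/

section Compactoid

variable {K : Type*} [NormedField K] [IsUltrametricDist K] {r : ℕ}

/-- Every family of coefficients in `∏_α 𝔭 ^ k(α)` comes from an element of `F`. -/
theorem mem_seriesSpace_of_isCompactoidNet {ϖ : K} (hϖ : IsUniformizer ϖ) :
    ∀ {m : ℕ} {k : (Fin m → ℤ) → WithTop ℤ}, IsCompactoidNet r k →
      ∀ {c : Coeffs K m}, (∀ α, c α ∈ primePow K (k α)) → c ∈ seriesSpace K r m
  | 0, _, _, _, _ => Submodule.mem_top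
  | m + 1, k, hk, c, hc => by
    have hs : ∀ i, coeffSlice K i c ∈ seriesSpace K r m := fun i =>
      mem_seriesSpace_of_isCompactoidNet hϖ (hk.slice i) fun β => hc _
    rw [seriesSpace]
    split_ifs with hm
    · refine ⟨hs, ?_, fun ε hε => ?_⟩
      · obtain ⟨d, hd⟩ := hk.bounded_last hm
        exact ⟨‖ϖ‖ ^ d, fun i β => primePow_le_coe (hd _) (hc _) ϖ hϖ⟩
      · obtain ⟨N, hN⟩ := exists_pow_lt_of_lt_one hε hϖ.2.1
        obtain ⟨j₀, hj⟩ := hk.tendsto_last hm N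
        refine ⟨j₀, fun i hi β => le_trans ?_ hN.le⟩
        rw [← zpow_natCast]
        exact primePow_le_coe (hj i hi β) (hc _) ϖ hϖ
    · obtain ⟨j₀, hj⟩ := hk.laurent_last hm
      refine ⟨hs, j₀, fun i hi => funext fun β => eq_zero_of_mem_primePow_top ?_⟩
      rw [← hj i hi β]
      exact hc _

/-- On a basic compactoid submodule, a neighbourhood of zero for the higher topology contains all
elements whose coefficients are close enough to zero for the topology of coefficientwise
convergence. -/
theorem IsZeroNhd.eventually_coeff {ϖ : K} (hϖ : IsUniformizer ϖ) :
    ∀ {m : ℕ} {k : (Fin m → ℤ) → WithTop ℤ}, IsCompactoidNet r k →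
      ∀ {Λ : Submodule (integers K) (HLF K r m)}, IsZeroNhd K r m Λ →
        ∀ᶠ c in 𝓝 (0 : Coeffs K m), ∀ x ∈ netSubmodule K r m k, coeff K r m x = c → x ∈ Λ
  | 0, k, hk, Λ, hΛ => by
    obtain ⟨n, hn⟩ := hΛ
    have h0 : Tendsto (fun c : Coeffs K 0 => c 0) (𝓝 0) (𝓝 0) := (continuous_apply 0).tendsto 0
    filter_upwards [h0 (primePow_mem_nhds hϖ n)] with c hc x _ hxc
    refine hn fun α => ?_
    rw [hxc, Subsingleton.elim α 0]
    exact hc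
  | m + 1, k, hk, Λ, hΛ => by
    obtain ⟨U, hU, hc, h⟩ := hΛ
    have hnet : ∀ i, ∀ x ∈ netSubmodule K r (m + 1) k, slice K r m i x ∈
        netSubmodule K r m fun β => k (Fin.snoc β i : Fin (m + 1) → ℤ) := fun i x hx β => hx _
    have hev : ∀ i, ∀ᶠ c in 𝓝 (0 : Coeffs K (m + 1)),
        ∀ x ∈ netSubmodule K r (m + 1) k, coeff K r (m + 1) x = c → slice K r m i x ∈ U i := by
      intro i
      have hcont : Continuous (coeffSlice K i : Coeffs K (m + 1) → Coeffs K m) :=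
        continuous_pi fun β => continuous_apply (Fin.snoc β i : Fin (m + 1) → ℤ)
      have ht := hcont.tendsto 0
      rw [map_zero] at ht
      filter_upwards [ht.eventually (IsZeroNhd.eventually_coeff hϖ (hk.slice i) (hU i))]
        with c hc x hx hxc
      exact hc _ (hnet i x hx) (hxc ▸ rfl)
    -- For `i` below `a` the net, and for `i` above `b` the neighbourhood, makes the condition on the
    -- coefficient of `tⁱ` automatic.
    obtain ⟨a, b, hab⟩ : ∃ a b : ℤ, ∀ i, i < a ∨ b ≤ i →
        ∀ x ∈ netSubmodule K r (m + 1) k, slice K r m i x ∈ U i := by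
      split_ifs at hc with hm
      · obtain ⟨⟨n, hn⟩, hlarge⟩ := hc
        obtain ⟨d, hd⟩ := hk.bounded_last hm
        obtain ⟨a, ha⟩ := hk.tendsto_last hm n
        obtain ⟨b, hb⟩ := hlarge d
        refine ⟨a, b, fun i hi x hx => ?_⟩
        rcases hi with hi | hi
        · exact hn i fun β => primePow_le_coe (ha i hi β) (hx _)
        · exact hb i hi fun β => primePow_le_coe (hd _) (hx _)
      · obtain ⟨a, ha⟩ := hk.laurent_last hm
        obtain ⟨b, hb⟩ := hc
        refine ⟨a, b, fun i hi x hx => ?_⟩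
        rcases hi with hi | hi
        · have hz : slice K r m i x = 0 := Subtype.ext <| funext fun β =>
            eq_zero_of_mem_primePow_top (ha i hi β ▸ hnet i x hx β)
          rw [hz]
          exact (U i).zero_mem
        · rw [hb i hi]
          exact Submodule.mem_top
    filter_upwards [(eventually_all_finite (Set.finite_Ico a b)).2 fun i _ => hev i]
      with c hc x hx hxc
    refine h x fun i => ?_
    by_cases hi : i ∈ Set.Ico a b
    · exact hc i hi x hx hxc
    · exact hab i (by rw [Set.mem_Ico] at hi; omega) x hx

instance (m : ℕ) : IsTopologicalAddGroup (HLF K r m) :=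
  (zeroBasis K r m).isTopologicalAddGroup

theorem isCompact_netSubmodule [ProperSpace K] {ϖ : K} (hϖ : IsUniformizer ϖ) {m : ℕ}
    {k : (Fin m → ℤ) → WithTop ℤ} (hk : IsCompactoidNet r k) :
    IsCompact (netSubmodule K r m k : Set (HLF K r m)) := by
  let P : Set (Coeffs K m) := {c | ∀ α, c α ∈ primePow K (k α)}
  have hP : IsCompact P := isCompact_pi_infinite fun α => isCompact_primePow hϖ (k α)
  let f : P → HLF K r m := fun c => ⟨c, mem_seriesSpace_of_isCompactoidNet hϖ hk c.2⟩
  have hf : Continuous f := by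
    refine continuous_iff_continuousAt.2 fun c => ?_
    refine ((zeroBasis K r m).nhds_hasBasis (f c)).tendsto_right_iff.2 ?_
    rintro _ ⟨Λ, hΛ, rfl⟩
    have ht : Tendsto (fun c' : P => (c' : Coeffs K m) - c) (𝓝 c) (𝓝 0) := by
      have : Continuous fun c' : P => (c' : Coeffs K m) - c := by fun_prop
      simpa using this.tendsto c
    filter_upwards [ht.eventually (IsZeroNhd.eventually_coeff hϖ hk hΛ)] with c' hc'
    refine ⟨f c' - f c, hc' (f c' - f c) (Submodule.sub_mem _ c'.2 c.2) rfl, ?_⟩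
    exact add_sub_cancel (f c) (f c')
  have := isCompact_iff_compactSpace.1 hP
  convert isCompact_range hf
  ext x
  exact ⟨fun hx => ⟨⟨coeff K r m x, hx⟩, rfl⟩, fun ⟨c, hc⟩ => hc ▸ c.2⟩

end Compactoid

/-! ### Compact submodules are c-compact -/

theorem isCCompact_of_isCompact {K : Type*} [NormedField K] [IsUltrametricDist K] {V : Type*}
    [AddCommGroup V] [Module K V] [TopologicalSpace V] [IsTopologicalAddGroup V]
    {A : Submodule (integers K) V} (hA : IsCompact (A : Set V)) : IsCCompact A := by
  intro S hne hS hdir x hx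
  choose b hb using fun Λ : S => Submodule.Quotient.mk_surjective _ (x Λ)
  have := isCompact_iff_compactSpace.1 hA
  have := hne.to_subtype
  -- The traces are taken in `A` rather than in `V`: `A` need not be closed, as `V` is not assumed to
  -- be Hausdorff.
  let C : S → Set A := fun Λ => {a | (a : V) - b Λ ∈ (Λ : Submodule (integers K) V)}
  have hclosed : ∀ Λ : S, IsClosed (C Λ) := by
    intro Λ
    have h : IsClosed ((Λ : Submodule (integers K) V) : Set V) :=
      AddSubgroup.isClosed_of_isOpen (Λ : Submodule (integers K) V).toAddSubgroup (hS Λ Λ.2).1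
    exact h.preimage (continuous_subtype_val.sub continuous_const)
  have hmono : ∀ Λ Λ' : S, (Λ : Submodule (integers K) V) ≤ Λ' → C Λ ⊆ C Λ' := by
    intro Λ Λ' h a ha
    have e := hx Λ Λ' h
    rw [← hb Λ, ← hb Λ'] at e
    have e' : ((b Λ : V) - b Λ') ∈ (Λ' : Submodule (integers K) V) :=
      (Submodule.Quotient.eq (Submodule.comap A.subtype Λ')).1 e
    have hadd := (Λ' : Submodule (integers K) V).add_mem (h ha) e'
    rwa [sub_add_sub_cancel] at hadd
  have hdirC : Directed (· ⊇ ·) C := by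
    intro Λ Λ'
    obtain ⟨Λ'', h'', h, h'⟩ := hdir Λ Λ.2 Λ' Λ'.2
    exact ⟨⟨Λ'', h''⟩, hmono ⟨Λ'', h''⟩ Λ h, hmono ⟨Λ'', h''⟩ Λ' h'⟩
  have hnonempty : ∀ Λ : S, (C Λ).Nonempty := fun Λ => ⟨b Λ, by simp [C]⟩
  obtain ⟨a, ha⟩ := IsCompact.nonempty_iInter_of_directed_nonempty_isCompact_isClosed C hdirC
    hnonempty (fun Λ => (hclosed Λ).isCompact) hclosed
  refine ⟨a, fun Λ => ?_⟩
  rw [← hb Λ]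
  exact (Submodule.Quotient.eq _).2 (Set.mem_iInter.1 ha Λ)

end HigherLocal

theorem mainTheorem5 {p : ℕ} [Fact p.Prime] {K : Type*} [NontriviallyNormedField K]
    [IsUltrametricDist K] [NormedAlgebra ℚ_[p] K] [FiniteDimensional ℚ_[p] K]
    (r m : ℕ) (hr : r ≤ m)
    (B : Submodule (HigherLocal.integers K) (HigherLocal.HLF K r m))
    (hB : HigherLocal.IsBasicCompactoid B) :
    HigherLocal.IsCCompact B := by
  have : ProperSpace K := FiniteDimensional.proper ℚ_[p] K
  obtain ⟨ϖ, hϖ⟩ := HigherLocal.exists_isUniformizer (K := K)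
  obtain ⟨k, hk, rfl⟩ := hB
  exact HigherLocal.isCCompact_of_isCompact (HigherLocal.isCompact_netSubmodule hϖ hk)
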